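/- All graphs are finite, simple and undirected. A cooperative coloring of graphs $G_1,\dots,G_m$ (not necessarily distinct) on the same vertex set $V$ is a choice of sets $I_1,\dots,I_m$, with $I_i$ independent in $G_i$, such that $\bigcup_{i=1}^m I_i=V$. A caterpillar is a tree in which deleting all pendant (degree-one) vertices leaves a path; the path may be a single vertex, or empty (as for $K_2$). Let $\mathcal{R}$ be the class of caterpillars and, for an integer $d\ge 0$, let $m_{\mathcal{R}}(d)$ be the minimum $m$ such that every family $G_1,\dots,G_m$ of $m$ caterpillars on a common vertex set, each of maximum degree at most $d$, has a cooperative coloring. Then $m_{\mathcal{R}}(d)$ is well defined (such an $m$ exists) for every $d$, and $$m_{\mathcal{R}}(d)=(1+o(1))\,\frac{\log d}{\log\log d}\qquad (d\to\infty).$$ -/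

import Mathlib

open Filter Asymptotics

namespace SimpleGraph

/-- A pendant vertex: a vertex with exactly one neighbor, i.e. a vertex of degree one. -/
def IsPendantVertex {V : Type*} (G : SimpleGraph V) (v : V) : Prop :=
  ∃! w, G.Adj v w

/-- A caterpillar: a tree such that deleting all its pendant vertices leaves a path. The path
may have a single vertex (the tree is then a star or a single vertex), and the graph with two
vertices and one edge, of which nothing is left (`n = 0`), counts as a caterpillar. -/
def IsCaterpillar {V : Type*} (G : SimpleGraph V) : Prop :=
  G.IsTree ∧ ∃ n : ℕ, Nonempty (G.induce {v | ¬ G.IsPendantVertex v} ≃g pathGraph n)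

/-- A cooperative coloring of a family of graphs on the same vertex set exists: there are
independent sets, one in each graph, whose union is the whole vertex set. -/
def HasCooperativeColoring {V : Type*} {m : ℕ} (G : Fin m → SimpleGraph V) : Prop :=
  ∃ I : Fin m → Set V, (∀ i, (G i).IsIndepSet (I i)) ∧ ⋃ i, I i = Set.univ

open Classical in
/-- Every family of `m` (not necessarily distinct) graphs from the class `𝒢`, on a common finite
vertex set and of maximum degree at most `d`, has a cooperative coloring. -/
def CooperativelyColorable (𝒢 : ∀ {V : Type}, SimpleGraph V → Prop) (d m : ℕ) : Prop :=
  ∀ (V : Type) [Fintype V] (G : Fin m → SimpleGraph V),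
    (∀ i, 𝒢 (G i)) → (∀ i, (G i).maxDegree ≤ d) → HasCooperativeColoring G

/-- `m_𝒢(d)`: the least `m` such that every family of `m` graphs from `𝒢`, on a common vertex
set and of maximum degree at most `d`, has a cooperative coloring. -/
noncomputable def cooperativeNumber (𝒢 : ∀ {V : Type}, SimpleGraph V → Prop) (d : ℕ) : ℕ :=
  sInf {m : ℕ | CooperativelyColorable 𝒢 d m}

end SimpleGraph

/-! Write x = log d / log log d. Upper bound: in a caterpillar the non-pendant vertices induce
maximum degree at most 2, and a pendant vertex has a single neighbor, its parent. Call a vertex big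
if it is non-pendant in at least 32N of the m graphs. An independent transversal gives each big
vertex a list of N such colors so that no color is shared by two big vertices adjacent in that
color; then any choice from the lists is conflict-free among big vertices. A small vertex is pendant
in at least s = m - 32N colors, and such a color fails only if the parent is big and chose it. If
all fail, the parents are distinct, so under random choices this has probability at most N^(-s). A
big vertex affects at most md small ones, so the local lemma applies once 4smd ≤ N^s; N a small
multiple of x and s about (1 + ε/2)x suffice. Lower bound: on the duplicate-free lists over m
colors, join in G_i each list containing i to its prefix before i. Repeatedly appending the color of
the current list never repeats a color, which is absurd after m + 1 steps. These star forests extend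
to caterpillars on at most (m + 1)^m vertices, and m = ⌊x⌋ is allowed. -/

/-! ### Local lemma and independent transversals -/

/-- A form of the symmetric Lovász local lemma: a family of forbidden partial assignments, each
on `s` variables with `N` possible values, can be avoided if no variable occurs in too many. -/
theorem exists_avoiding_partial_assignments {X E : Type*} [Fintype X] [DecidableEq X] [Fintype E]
    [DecidableEq E] {N s Δ : ℕ} (S : E → Finset X) (φ : E → X → Fin N) (hs : 0 < s) (hN : 0 < N)
    (hS : ∀ e, (S e).card = s)
    (hΔ : ∀ x, (Finset.univ.filter fun e => x ∈ S e).card ≤ Δ) (h : 4 * s * Δ ≤ N ^ s) :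
    ∃ a : X → Fin N, ∀ e, ∃ x ∈ S e, a x ≠ φ e x := by
  classical
  let A : Finset E → Finset (X → Fin N) := fun T =>
    Finset.univ.filter fun a => ∀ e ∈ T, ∃ x ∈ S e, a x ≠ φ e x
  let B : Finset E → E → Finset (X → Fin N) := fun T e =>
    (A T).filter fun a => ∀ x ∈ S e, a x = φ e x
  have memA : ∀ T a, a ∈ A T ↔ ∀ e ∈ T, ∃ x ∈ S e, a x ≠ φ e x := fun T a => by simp [A]
  have memB : ∀ T e a, a ∈ B T e ↔ a ∈ A T ∧ ∀ x ∈ S e, a x = φ e x := fun T e a => by simp [B]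
  have hanti : ∀ T T', T' ⊆ T → A T ⊆ A T' := fun T T' hT a ha => by
    rw [memA] at ha ⊢
    exact fun e he => ha e (hT he)
  have indep : ∀ T e, (∀ f ∈ T, Disjoint (S e) (S f)) → N ^ s * (B T e).card ≤ (A T).card := by
    intro T e hT
    have hcard : N ^ s * (B T e).card =
        ((Finset.univ : Finset (S e → Fin N)) ×ˢ B T e).card := by
      rw [Finset.card_product, Finset.card_univ, Fintype.card_fun, Fintype.card_fin,
        Fintype.card_coe, hS]
    rw [hcard]
    -- Overwriting `a` on `S e` by arbitrary values stays in `A T`, because `T` only looks outside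
    -- `S e`; it is injective because `a` was prescribed on `S e`.
    refine Finset.card_le_card_of_injOn
      (fun p x => if hx : x ∈ S e then p.1 ⟨x, hx⟩ else p.2 x) ?_ ?_
    · rintro ⟨b, a⟩ hp
      have ha := (Finset.mem_product.1 (Finset.mem_coe.1 hp)).2
      simp only [memB, memA] at ha
      refine Finset.mem_coe.2 ((memA _ _).2 fun f hf => ?_)
      obtain ⟨x, hx, hne⟩ := ha.1 f hf
      refine ⟨x, hx, ?_⟩
      have : x ∉ S e := fun hxe => (Finset.disjoint_left.1 (hT f hf)) hxe hx
      simpa [this] using hne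
    · rintro ⟨b, a⟩ hp ⟨b', a'⟩ hp' heq
      have ha := (Finset.mem_product.1 (Finset.mem_coe.1 hp)).2
      have ha' := (Finset.mem_product.1 (Finset.mem_coe.1 hp')).2
      simp only [memB] at ha ha'
      refine Prod.ext (funext fun x => ?_) (funext fun x => ?_)
      · have := congrFun heq x.1
        simpa using this
      · by_cases hx : x ∈ S e
        · simp only [ha.2 x hx, ha'.2 x hx]
        · have := congrFun heq x
          simpa [hx] using this
  -- Conditioned on avoiding `T`, the event `e` has probability at most 2/N^s.
  have key : ∀ n T, T.card = n → ∀ e, N ^ s * (B T e).card ≤ 2 * (A T).card := by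
    intro n
    induction n using Nat.strong_induction_on with
    | _ n ih =>
      intro T hTn e
      set Γ := T.filter fun f => ¬ Disjoint (S e) (S f) with hΓ
      rcases Γ.eq_empty_or_nonempty with hΓe | hΓne
      · have := indep T e fun f hf => by
          by_contra hd
          have : f ∈ Γ := Finset.mem_filter.2 ⟨hf, hd⟩
          simp [hΓe] at this
        omega
      set T' := T.filter fun f => Disjoint (S e) (S f) with hT'
      have hT'T : T' ⊆ T := Finset.filter_subset _ _
      have hlt : T'.card < n := by
        obtain ⟨f, hf⟩ := hΓne
        rw [← hTn]
        exact Finset.card_lt_card (Finset.filter_ssubset.2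
          ⟨f, (Finset.mem_filter.1 hf).1, (Finset.mem_filter.1 hf).2⟩)
      have h1 : N ^ s * (B T e).card ≤ (A T').card :=
        (Nat.mul_le_mul_left _ (Finset.card_le_card
          (Finset.filter_subset_filter _ (hanti T T' hT'T)))).trans
          (indep T' e fun f hf => (Finset.mem_filter.1 hf).2)
      have hΓcard : Γ.card ≤ s * Δ := by
        have : Γ ⊆ (S e).biUnion fun x => Finset.univ.filter fun f => x ∈ S f := by
          intro f hf
          obtain ⟨x, hx, hx'⟩ := Finset.not_disjoint_iff.1 (Finset.mem_filter.1 hf).2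
          exact Finset.mem_biUnion.2 ⟨x, hx, by simpa using hx'⟩
        refine (Finset.card_le_card this).trans ?_
        rw [← hS e]
        exact Finset.card_biUnion_le_card_mul _ _ _ fun x _ => hΔ x
      have h2 : (A T').card ≤ (A T).card + ∑ f ∈ Γ, (B T' f).card := by
        have : A T' ⊆ A T ∪ Γ.biUnion fun f => B T' f := by
          intro a ha
          by_cases haT : a ∈ A T
          · exact Finset.mem_union_left _ haT
          refine Finset.mem_union_right _ (Finset.mem_biUnion.2 ?_)
          rw [memA] at haT
          push Not at haT
          obtain ⟨f, hf, hfa⟩ := haT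
          refine ⟨f, Finset.mem_filter.2 ⟨hf, fun hd => ?_⟩, (memB _ _ _).2 ⟨ha, hfa⟩⟩
          obtain ⟨x, hx, hne⟩ := (memA _ _).1 ha f (Finset.mem_filter.2 ⟨hf, hd⟩)
          exact hne (hfa x hx)
        exact (Finset.card_le_card this).trans ((Finset.card_union_le _ _).trans
          (Nat.add_le_add_left Finset.card_biUnion_le _))
      have h3 : N ^ s * ∑ f ∈ Γ, (B T' f).card ≤ s * Δ * (2 * (A T').card) := by
        rw [Finset.mul_sum]
        refine (Finset.sum_le_card_nsmul _ _ _ fun f _ => ih _ hlt T' rfl f).trans ?_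
        rw [smul_eq_mul]
        exact Nat.mul_le_mul_right _ hΓcard
      -- The events of `T` meeting `e` remove at most half of `A T'`, so passing from `T` to `T'`
      -- costs the factor 2 in `key`.
      have h4 : 2 * (N ^ s * ∑ f ∈ Γ, (B T' f).card) ≤ N ^ s * (A T').card :=
        calc _ ≤ 2 * (s * Δ * (2 * (A T').card)) := Nat.mul_le_mul_left _ h3
          _ = 4 * s * Δ * (A T').card := by ring
          _ ≤ _ := Nat.mul_le_mul_right _ h
      have hpos : 0 < N ^ s := pow_pos hN s
      have h5 : 2 * ∑ f ∈ Γ, (B T' f).card ≤ (A T').card := by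
        refine Nat.le_of_mul_le_mul_left ?_ hpos
        linarith
      omega
  have hpos : ∀ T, 0 < (A T).card := by
    intro T
    induction T using Finset.induction_on with
    | empty => exact Finset.card_pos.2 ⟨fun _ => ⟨0, hN⟩, by simp [A]⟩
    | insert e T he ih =>
      have h1 := key _ T rfl e
      have h2 : (A T).card ≤ (A (insert e T)).card + (B T e).card := by
        have : A T ⊆ A (insert e T) ∪ B T e := by
          intro a ha
          by_cases hae : ∀ x ∈ S e, a x = φ e x
          · exact Finset.mem_union_right _ ((memB _ _ _).2 ⟨ha, hae⟩)
          push Not at hae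
          refine Finset.mem_union_left _ ((memA _ _).2 fun f hf => ?_)
          rcases Finset.mem_insert.1 hf with rfl | hf
          · exact hae
          · exact (memA _ _).1 ha f hf
        exact (Finset.card_le_card this).trans (Finset.card_union_le _ _)
      have h4 : 4 ≤ N ^ s := by
        obtain ⟨x, hx⟩ := Finset.card_pos.1 (hs.trans_eq (hS e).symm)
        have : 0 < Δ := lt_of_lt_of_le (Finset.card_pos.2 ⟨e, by simpa using hx⟩) (hΔ x)
        nlinarith [Nat.mul_pos hs this]
      have h5 := Nat.mul_le_mul_right (B T e).card h4
      omega
  obtain ⟨a, ha⟩ := Finset.card_pos.1 (hpos Finset.univ)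
  exact ⟨a, fun e => (memA _ _).1 ha e (Finset.mem_univ e)⟩

namespace SimpleGraph

/-- A graph of maximum degree at most `Δ` whose vertices are partitioned into parts of size
`g ≥ 16 Δ` has an independent transversal. -/
theorem exists_independent_transversal {X : Type*} [Fintype X] [DecidableEq X] {g Δ : ℕ}
    (hg : 0 < g) (H : SimpleGraph (X × Fin g)) [DecidableRel H.Adj] (hH : ∀ y, H.degree y ≤ Δ)
    (h : 16 * Δ ≤ g) :
    ∃ a : X → Fin g, ∀ x y, ¬ H.Adj (x, a x) (y, a y) := by
  let E := {p : (X × Fin g) × (X × Fin g) // H.Adj p.1 p.2 ∧ p.1.1 ≠ p.2.1}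
  let S : E → Finset X := fun e => {e.1.1.1, e.1.2.1}
  let φ : E → X → Fin g := fun e x => if x = e.1.1.1 then e.1.1.2 else e.1.2.2
  have hcount : ∀ x, (Finset.univ.filter fun e : E => x ∈ S e).card ≤ 2 * (g * Δ) := by
    intro x
    let D : Finset ((X × Fin g) × (X × Fin g)) :=
      (Finset.univ : Finset (Fin g)).biUnion fun t =>
        (H.neighborFinset (x, t)).image fun z => ((x, t), z)
    have hD : D.card ≤ g * Δ := by
      refine (Finset.card_biUnion_le_card_mul _ _ Δ fun t _ =>
        Finset.card_image_le.trans (hH (x, t))).trans ?_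
      simp
    rw [← Finset.card_map (Function.Embedding.subtype _)]
    have : (Finset.univ.filter fun e : E => x ∈ S e).map (Function.Embedding.subtype _) ⊆
        D ∪ D.image Prod.swap := by
      rintro ⟨⟨u, t⟩, ⟨w, r⟩⟩ hp
      simp only [Finset.mem_map, Finset.mem_filter, Finset.mem_univ, true_and,
        Function.Embedding.subtype_apply] at hp
      obtain ⟨⟨e, hadj, hne⟩, hx, rfl⟩ := hp
      simp only [S, Finset.mem_insert, Finset.mem_singleton] at hx
      rcases hx with rfl | rfl
      · refine Finset.mem_union_left _ ?_
        simpa [D] using hadj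
      · refine Finset.mem_union_right _ (Finset.mem_image.2 ⟨((x, r), (u, t)), ?_, rfl⟩)
        simpa [D] using hadj.symm
    refine (Finset.card_le_card this).trans ((Finset.card_union_le _ _).trans ?_)
    have := Finset.card_image_le (s := D) (f := Prod.swap)
    omega
  -- Here `s = 2` and each part meets at most 2gΔ edges, so the condition reads 16gΔ ≤ g². Edges
  -- inside a part cannot be violated by a transversal.
  obtain ⟨a, ha⟩ := exists_avoiding_partial_assignments S φ two_pos hg
    (fun e => Finset.card_pair e.2.2) hcount (by nlinarith)
  refine ⟨a, fun x y hxy => ?_⟩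
  by_cases hne : x = y
  · subst hne
    exact H.irrefl hxy
  obtain ⟨z, hz, hza⟩ := ha ⟨((x, a x), (y, a y)), hxy, hne⟩
  simp only [S, Finset.mem_insert, Finset.mem_singleton] at hz
  rcases hz with rfl | rfl
  · simp [φ] at hza
  · simp [φ, Ne.symm hne] at hza

/-! ### Upper bound: coloring caterpillars -/

/-- If few vertices outside the sets `C i` are attached to a common vertex of `C i`, and these
sets induce graphs of maximum degree at most two, then a cooperative coloring exists. -/
theorem hasCooperativeColoring_of_core {V : Type*} [Fintype V] {m : ℕ} (N s d : ℕ)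
    (G : Fin m → SimpleGraph V) (C : Fin m → Set V) (P : Fin m → V → V)
    (hC : ∀ i, ∀ v ∈ C i, {w | w ∈ C i ∧ (G i).Adj v w}.ncard ≤ 2)
    (hP : ∀ i, ∀ v ∉ C i, P i v ∈ C i ∧ ∀ w, (G i).Adj v w ↔ w = P i v)
    (hd : ∀ i v, {w | (G i).Adj v w}.ncard ≤ d)
    (hs : 0 < s) (hN : 0 < N) (hm : s + 32 * N ≤ m) (h : 4 * s * (m * d) ≤ N ^ s) :
    HasCooperativeColoring G := by
  classical
  let cs : V → Finset (Fin m) := fun v => Finset.univ.filter fun i => v ∈ C i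
  have mem_cs : ∀ v i, i ∈ cs v ↔ v ∈ C i := fun v i => by simp [cs]
  -- N blocks of 32 colors: 32 = 16 · 2 is the part size needed for conflict degree 2.
  let Big := {v : V // N * 32 ≤ (cs v).card}
  have hemb : ∀ v : Big, Nonempty (Fin N × Fin 32 ↪ cs v.1) := fun v => by
    refine Function.Embedding.nonempty_of_card_le ?_
    simpa using v.2
  let e : ∀ v : Big, Fin N × Fin 32 ↪ cs v.1 := fun v => (hemb v).some
  have he : ∀ v p, v.1 ∈ C (e v p).1 := fun v p => (mem_cs _ _).1 (e v p).2
  have einj : ∀ v p q, (e v p).1 = (e v q).1 → p = q := fun v p q hpq =>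
    (e v).injective (Subtype.ext hpq)
  -- the conflict graph of the candidate colors of the large vertices
  let c : (Big × Fin N) × Fin 32 → Fin m := fun y => (e y.1.1 (y.1.2, y.2)).1
  let H : SimpleGraph ((Big × Fin N) × Fin 32) :=
    { Adj := fun y z => c y = c z ∧ (G (c y)).Adj y.1.1.1 z.1.1.1
      symm := ⟨fun y z hyz => ⟨hyz.1.symm, hyz.1 ▸ hyz.2.symm⟩⟩
      loopless := ⟨fun y hy => (G (c y)).irrefl hy.2⟩ }
  have hH : ∀ y, H.degree y ≤ 2 := by
    intro y
    have hy : y.1.1.1 ∈ C (c y) := he _ _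
    refine le_trans ?_ (hC _ _ hy)
    rw [← card_neighborFinset_eq_degree, ← Set.ncard_coe_finset]
    -- A neighbor in `H` carries the color of `y`, and a vertex uses each color in only one slot, so
    -- the vertex determines the neighbor.
    refine Set.ncard_le_ncard_of_injOn (fun z => z.1.1.1) ?_ ?_ (Set.toFinite _)
    · intro z hz
      have hz : H.Adj y z := by simpa using hz
      have hzC : z.1.1.1 ∈ C (c z) := he _ _
      exact ⟨hz.1 ▸ hzC, hz.2⟩
    · rintro ⟨⟨v, j⟩, t⟩ hz ⟨⟨w, k⟩, r⟩ hz' hvw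
      have hz : H.Adj y ((v, j), t) := by simpa using hz
      have hz' : H.Adj y ((w, k), r) := by simpa using hz'
      obtain rfl : v = w := Subtype.ext hvw
      have := einj v _ _ (hz.1.symm.trans hz'.1)
      simp only [Prod.mk.injEq] at this
      simp [this.1, this.2]
  obtain ⟨b, hb⟩ := exists_independent_transversal (by norm_num) H hH (by norm_num)
  let D : Big → Fin N → Fin m := fun v j => (e v (j, b (v, j))).1
  have hDC : ∀ v j, v.1 ∈ C (D v j) := fun v j => he _ _
  have hDinj : ∀ v, Function.Injective (D v) := fun v j k hjk =>
    congrArg Prod.fst (einj v _ _ hjk)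
  have hD : ∀ v j w k, D v j = D w k → ¬ (G (D v j)).Adj v.1 w.1 := fun v j w k hvw hadj =>
    hb (v, j) (w, k) ⟨hvw, hadj⟩
  -- the random choice of the large vertices
  let blocked : (Big → Fin N) → V → Fin m → Prop := fun a v i =>
    ∃ x : Big, x.1 = P i v ∧ D x (a x) = i
  have main : ∃ a : Big → Fin N, ∀ v, (cs v).card < N * 32 → ∃ i, v ∉ C i ∧ ¬ blocked a v i := by
    -- Only these small vertices can have all their pendant colors blocked: equal parents in two
    -- colors would force one big vertex to choose both.
    let E := {v : V // (cs v).card < N * 32 ∧ (∀ i, v ∉ C i → ∃ x : Big, x.1 = P i v ∧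
      ∃ j, D x j = i) ∧ ∀ i j, v ∉ C i → v ∉ C j → P i v = P j v → i = j}
    have hL : ∀ v : E, ∃ L : Finset (Fin m), L ⊆ (cs v.1)ᶜ ∧ L.card = s := fun v => by
      refine Finset.exists_subset_card_eq ?_
      have := v.2.1
      rw [Finset.card_compl, Fintype.card_fin]
      omega
    choose L hLsub hLcard using hL
    have hLC : ∀ v i, i ∈ L v → v.1 ∉ C i := fun v i hi hv =>
      Finset.mem_compl.1 (hLsub v hi) ((mem_cs _ _).2 hv)
    let S : E → Finset Big := fun v => Finset.univ.filter fun x => ∃ i ∈ L v, x.1 = P i v.1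
    -- The one choice of `x` that blocks `v`; the default 0 is never used for `x ∈ S v`.
    let φ : E → Big → Fin N := fun v x =>
      if hx : ∃ j, v.1 ∉ C (D x j) ∧ x.1 = P (D x j) v.1 then hx.choose else ⟨0, hN⟩
    have hScard : ∀ v, (S v).card = s := by
      intro v
      rw [← hLcard v, ← Finset.card_map (Function.Embedding.subtype _)]
      have : (S v).map (Function.Embedding.subtype _) = (L v).image fun i => P i v.1 := by
        ext u
        simp only [Finset.mem_map, Finset.mem_image, S, Finset.mem_filter, Finset.mem_univ,
          true_and, Function.Embedding.subtype_apply]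
        constructor
        · rintro ⟨x, ⟨i, hi, hx⟩, rfl⟩
          exact ⟨i, hi, hx.symm⟩
        · rintro ⟨i, hi, rfl⟩
          obtain ⟨x, hx, -⟩ := v.2.2.1 i (hLC v i hi)
          exact ⟨x, ⟨i, hi, hx⟩, hx⟩
      rw [this]
      exact Finset.card_image_of_injOn fun i hi j hj hij =>
        v.2.2.2 i j (hLC v i hi) (hLC v j hj) hij
    have hdeg : ∀ x, (Finset.univ.filter fun v => x ∈ S v).card ≤ m * d := by
      intro x
      rw [← Finset.card_map (Function.Embedding.subtype _)]
      have : (Finset.univ.filter fun v => x ∈ S v).map (Function.Embedding.subtype _) ⊆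
          (Finset.univ : Finset (Fin m)).biUnion fun i =>
            Finset.univ.filter fun w => (G i).Adj x.1 w := by
        intro u hu
        simp only [Finset.mem_map, Finset.mem_filter, Finset.mem_univ, true_and, S,
          Function.Embedding.subtype_apply] at hu
        obtain ⟨v, ⟨i, hi, hx⟩, rfl⟩ := hu
        simp only [Finset.mem_biUnion, Finset.mem_filter, Finset.mem_univ, true_and]
        exact ⟨i, (((hP i v.1 (hLC v i hi)).2 _).2 hx).symm⟩
      refine (Finset.card_le_card this).trans ((Finset.card_biUnion_le_card_mul _ _ d
        fun i _ => ?_).trans (by simp))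
      refine le_trans (le_of_eq ?_) (hd i x.1)
      rw [← Set.ncard_coe_finset]
      simp
    obtain ⟨a, ha⟩ := exists_avoiding_partial_assignments S φ hs hN hScard hdeg h
    refine ⟨a, fun v hv => ?_⟩
    by_contra! hcon
    have hinj : ∀ i j, v ∉ C i → v ∉ C j → P i v = P j v → i = j := by
      intro i j hi hj hij
      obtain ⟨x, hx, hxi⟩ := hcon i hi
      obtain ⟨y, hy, hyj⟩ := hcon j hj
      obtain rfl : x = y := Subtype.ext (hx.trans (hij.trans hy.symm))
      exact hxi.symm.trans hyj
    obtain ⟨x, hx, hne⟩ := ha ⟨v, hv, fun i hi => by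
      obtain ⟨x, hx, hxi⟩ := hcon i hi
      exact ⟨x, hx, _, hxi⟩, hinj⟩
    simp only [S, Finset.mem_filter, Finset.mem_univ, true_and] at hx
    obtain ⟨i, hi, hxi⟩ := hx
    have hvi := hLC _ i hi
    obtain ⟨y, hy, hyi⟩ := hcon i hvi
    obtain rfl : x = y := Subtype.ext (hxi.trans hy.symm)
    have hex : ∃ j, v ∉ C (D x j) ∧ x.1 = P (D x j) v := ⟨a x, by rw [hyi]; exact ⟨hvi, hxi⟩⟩
    refine hne ?_
    simp only [φ, dif_pos hex]
    refine hDinj x (hyi.trans (hinj _ _ hvi hex.choose_spec.1 ?_))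
    exact hxi.symm.trans hex.choose_spec.2
  obtain ⟨a, ha⟩ := main
  have hcol : ∀ v, ∃ i, (∃ hv : N * 32 ≤ (cs v).card, D ⟨v, hv⟩ (a ⟨v, hv⟩) = i) ∨
      (v ∉ C i ∧ ¬ blocked a v i) := fun v => by
    by_cases hv : N * 32 ≤ (cs v).card
    · exact ⟨_, Or.inl ⟨hv, rfl⟩⟩
    · obtain ⟨i, hi⟩ := ha v (not_le.1 hv)
      exact ⟨i, Or.inr hi⟩
  choose f hf using hcol
  -- The only neighbor of `v` in color `i` is its parent, non-pendant there: if big it did not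
  -- choose `i`, and if small it only takes colors where it is pendant.
  have hleaf : ∀ v w i, f v = i → f w = i → v ∉ C i → ¬ blocked a v i → ¬ (G i).Adj v w := by
    rintro v w i hv hw hvC hbl hadj
    have hwP := ((hP i v hvC).2 w).1 hadj
    have hwC : w ∈ C i := hwP ▸ (hP i v hvC).1
    rcases hf w with ⟨hbig, hDw⟩ | ⟨hwC', -⟩
    · exact hbl ⟨⟨w, hbig⟩, hwP, hDw.trans hw⟩
    · exact hwC' (hw ▸ hwC)
  refine ⟨fun i => {v | f v = i}, fun i v hv w hw _ hadj => ?_, ?_⟩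
  · have hv : f v = i := hv
    have hw : f w = i := hw
    rcases hf v with ⟨hvb, hDv⟩ | ⟨hvC, hvbl⟩
    · rcases hf w with ⟨hwb, hDw⟩ | ⟨hwC, hwbl⟩
      · have hDv := hDv.trans hv
        have hDw := hDw.trans hw
        exact hD ⟨v, hvb⟩ _ ⟨w, hwb⟩ _ (hDv.trans hDw.symm) (by rw [hDv]; exact hadj)
      · rw [hw] at hwC hwbl
        exact hleaf w v i hw hv hwC hwbl hadj.symm
    · rw [hv] at hvC hvbl
      exact hleaf v w i hv hw hvC hvbl hadj
  · ext v
    simp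

theorem eq_univ_of_adj_pendant {V : Type*} {G : SimpleGraph V} (hG : G.Connected) {v w : V}
    (hv : G.IsPendantVertex v) (hw : G.IsPendantVertex w) (hvw : G.Adj v w) (u : V) :
    u = v ∨ u = w := by
  have hwalk : ∀ x y (p : G.Walk x y), (x = v ∨ x = w) → (y = v ∨ y = w) := by
    intro x y p
    induction p with
    | nil => exact id
    | cons hadj p ih =>
      rintro (rfl | rfl)
      · exact ih (Or.inr (hv.unique hadj hvw))
      · exact ih (Or.inl (hw.unique hadj hvw.symm))
  obtain ⟨p⟩ := hG.preconnected v u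
  exact hwalk v u p (Or.inl rfl)

theorem IsCaterpillar.ncard_core_neighbors_le_two {V : Type*} {G : SimpleGraph V}
    (hG : G.IsCaterpillar) {v : V} (hv : ¬ G.IsPendantVertex v) :
    {w | ¬ G.IsPendantVertex w ∧ G.Adj v w}.ncard ≤ 2 := by
  obtain ⟨-, n, ⟨ψ⟩⟩ := hG
  let x : {v | ¬ G.IsPendantVertex v} := ⟨v, hv⟩
  have hsub : {w | ¬ G.IsPendantVertex w ∧ G.Adj v w} ⊆
      (fun k : Fin n => (ψ.symm k).1) '' {k | (ψ x).val + 1 = k.val ∨ k.val + 1 = (ψ x).val} := by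
    rintro w ⟨hw, hvw⟩
    let y : {v | ¬ G.IsPendantVertex v} := ⟨w, hw⟩
    have hadj : (pathGraph n).Adj (ψ x) (ψ y) := ψ.map_adj_iff.2 hvw
    exact ⟨ψ y, pathGraph_adj.1 hadj, by simp [y]⟩
  refine (Set.ncard_le_ncard hsub (Set.toFinite _)).trans
    ((Set.ncard_image_le (Set.toFinite _)).trans ?_)
  have : {k : Fin n | (ψ x).val + 1 = k.val ∨ k.val + 1 = (ψ x).val}.ncard ≤
      ({(ψ x).val + 1, (ψ x).val - 1} : Set ℕ).ncard :=
    Set.ncard_le_ncard_of_injOn (fun k => k.val)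
      (fun k hk => by
        simp only [Set.mem_ofPred_eq] at hk
        simp only [Set.mem_insert_iff, Set.mem_singleton_iff]
        omega)
      (fun k _ l _ hkl => Fin.ext hkl) (Set.toFinite _)
  exact this.trans ((Set.ncard_insert_le _ _).trans (by rw [Set.ncard_singleton]))

theorem cooperativelyColorable_isCaterpillar {d m : ℕ} (N s : ℕ) (hs : 0 < s) (hN : 0 < N)
    (hm : s + 32 * N ≤ m) (h : 4 * s * (m * d) ≤ N ^ s) :
    CooperativelyColorable IsCaterpillar d m := by
  classical
  intro V _ G hG hGd
  -- Two adjacent pendant vertices force K₂, where parents would be pendant; two singletons then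
  -- cover everything.
  by_cases hK : ∃ i v w, (G i).IsPendantVertex v ∧ (G i).IsPendantVertex w ∧ (G i).Adj v w
  · obtain ⟨i, v, w, hv, hw, hvw⟩ := hK
    refine ⟨fun j => if j.val = 0 then {v} else {w}, fun j => ?_, ?_⟩
    · dsimp only
      split_ifs <;> exact Set.pairwise_singleton _ _
    · refine Set.eq_univ_of_forall fun u => Set.mem_iUnion.2 ?_
      rcases eq_univ_of_adj_pendant (hG i).1.connected hv hw hvw u with rfl | rfl
      · exact ⟨⟨0, by omega⟩, by simp⟩
      · exact ⟨⟨1, by omega⟩, by simp⟩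
  · push Not at hK
    have hP : ∀ i v, ∃ p, (G i).IsPendantVertex v →
        ¬ (G i).IsPendantVertex p ∧ ∀ w, (G i).Adj v w ↔ w = p := fun i v => by
      by_cases hv : (G i).IsPendantVertex v
      · obtain ⟨p, hp, huniq⟩ := id hv
        exact ⟨p, fun _ => ⟨fun hpp => hK i v p hv hpp hp,
          fun w => ⟨huniq w, fun hw => hw ▸ hp⟩⟩⟩
      · exact ⟨v, fun hv' => absurd hv' hv⟩
    choose P hP using hP
    refine hasCooperativeColoring_of_core N s d G (fun i => {v | ¬ (G i).IsPendantVertex v}) P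
      (fun i v hv => (hG i).ncard_core_neighbors_le_two hv)
      (fun i v hv => hP i v (not_not.1 hv)) (fun i v => ?_) hs hN hm h
    refine le_trans (le_of_eq ?_) (((G i).degree_le_maxDegree v).trans (hGd i))
    rw [← card_neighborFinset_eq_degree, ← Set.ncard_coe_finset]
    congr 1
    ext w
    simp

/-! ### Lower bound: caterpillars from prefixes of lists -/

/-- Following parents lowers the rank until the root, so the graph is connected; edges are covered
by the non-root vertices, so there are few enough of them for a tree. -/
theorem isTree_of_parent {V : Type*} [Finite V] {G : SimpleGraph V} (r : V) (par : V → V)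
    (rank : V → ℕ) (hrank : ∀ v, v ≠ r → rank (par v) < rank v)
    (hG : ∀ u v, G.Adj u v ↔ (u ≠ r ∧ v = par u) ∨ (v ≠ r ∧ u = par v)) : G.IsTree := by
  have hreach : ∀ n v, rank v = n → G.Reachable v r := by
    intro n
    induction n using Nat.strong_induction_on with
    | _ n ih =>
      intro v hv
      by_cases hvr : v = r
      · rw [hvr]
      · have hadj : G.Adj v (par v) := (hG _ _).2 (Or.inl ⟨hvr, rfl⟩)
        exact hadj.reachable.trans (ih _ (hv ▸ hrank v hvr) _ rfl)
  have hconn : G.Connected :=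
    { preconnected := fun u v => (hreach _ u rfl).trans (hreach _ v rfl).symm
      nonempty := ⟨r⟩ }
  refine isTree_iff_connected_and_card.2
    ⟨hconn, le_antisymm ?_ hconn.card_vert_le_card_edgeSet_add_one⟩
  have hsub : G.edgeSet ⊆ (fun v => s(v, par v)) '' {v | v ≠ r} := by
    intro e
    induction e using Sym2.ind with
    | _ u v =>
      intro huv
      rcases (hG u v).1 huv with ⟨hu, rfl⟩ | ⟨hv, rfl⟩
      · exact ⟨u, hu, rfl⟩
      · exact ⟨v, hv, Sym2.eq_swap⟩
  have h1 : Nat.card G.edgeSet ≤ {v | v ≠ r}.ncard :=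
    (Set.ncard_le_ncard hsub (Set.toFinite _)).trans (Set.ncard_image_le (Set.toFinite _))
  have h2 : {v | v ≠ r}.ncard < (Set.univ : Set V).ncard :=
    Set.ncard_lt_ncard ⟨Set.subset_univ _, fun h => h (Set.mem_univ r) rfl⟩ (Set.toFinite _)
  rw [Set.ncard_univ] at h2
  omega

/-- A star forest with at least two components, none of them a single vertex, is contained in a
caterpillar. The star forest is given by the map that sends each vertex to the center of its
star. -/
theorem exists_isCaterpillar_of_star_forest {V : Type*} [Finite V] (c : V → V)
    (hc : ∀ v, c (c v) = c v) (hleaf : ∀ z, c z = z → ∃ v, v ≠ z ∧ c v = z)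
    (htwo : ∃ z w, c z = z ∧ c w = w ∧ z ≠ w) :
    ∃ G : SimpleGraph V, G.IsCaterpillar ∧ ∀ v, c v ≠ v → G.Adj v (c v) := by
  classical
  have := Fintype.ofFinite V
  let Z : Set V := {z | c z = z}
  obtain ⟨n, ⟨e⟩⟩ : ∃ n, Nonempty (Z ≃ Fin n) := ⟨_, ⟨Fintype.equivFin Z⟩⟩
  have hn : 2 ≤ n := by
    obtain ⟨z, w, hz, hw, hzw⟩ := htwo
    have hne : e ⟨z, hz⟩ ≠ e ⟨w, hw⟩ := fun h => hzw (congrArg Subtype.val (e.injective h))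
    have := Fin.val_ne_of_ne hne
    omega
  let r : V := (e.symm ⟨0, by omega⟩).1
  have hr : c r = r := (e.symm ⟨0, by omega⟩).2
  have her : (e ⟨r, hr⟩).val = 0 := by
    change (e (e.symm ⟨0, by omega⟩)).val = 0
    simp
  -- The centers are strung into a path rooted at index 0. Truncated subtraction sends the root to
  -- itself, which the guards `v ≠ r` in `G` exclude.
  let par : V → V := fun v =>
    if h : c v = v then (e.symm ⟨(e ⟨v, h⟩).val - 1, by omega⟩).1 else c v
  let rank : V → ℕ := fun v => if h : c v = v then (e ⟨v, h⟩).val else n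
  have par_leaf : ∀ v, c v ≠ v → par v = c v := fun v hv => dif_neg hv
  have par_center : ∀ v (h : c v = v) w (h' : c w = w), w = par v ↔
      (e ⟨w, h'⟩).val = (e ⟨v, h⟩).val - 1 := by
    intro v h w h'
    simp only [par, dif_pos h]
    constructor
    · intro hw
      have : (⟨w, h'⟩ : Z) = e.symm ⟨(e ⟨v, h⟩).val - 1, by omega⟩ := Subtype.ext hw
      rw [this]
      simp
    · intro hw
      have : (⟨w, h'⟩ : Z) = e.symm ⟨(e ⟨v, h⟩).val - 1, by omega⟩ := by
        rw [Equiv.eq_symm_apply]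
        exact Fin.ext hw
      exact congrArg Subtype.val this
  have cpar : ∀ v, c (par v) = par v := by
    intro v
    by_cases h : c v = v
    · simp only [par, dif_pos h]
      exact (e.symm _).2
    · rw [par_leaf v h, hc]
  have hroot : ∀ v (h : c v = v), v ≠ r ↔ (e ⟨v, h⟩).val ≠ 0 := by
    intro v h
    rw [not_iff_not]
    constructor
    · rintro rfl
      exact her
    · intro h0
      have : e ⟨v, h⟩ = e ⟨r, hr⟩ := Fin.ext (h0.trans her.symm)
      exact congrArg Subtype.val (e.injective this)
  have leaf_ne_root : ∀ v, c v ≠ v → v ≠ r := fun v hv h => hv (by rw [h, hr])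
  have hrank : ∀ v, v ≠ r → rank (par v) < rank v := by
    intro v hv
    by_cases h : c v = v
    · have h1 := (par_center v h (par v) (cpar v)).1 rfl
      have h2 := (hroot v h).1 hv
      simp only [rank, dif_pos h, dif_pos (cpar v)]
      omega
    · simp only [rank, dif_neg h, dif_pos (cpar v)]
      omega
  have hne : ∀ v, v ≠ r → v ≠ par v := fun v hv h => by
    have := hrank v hv
    rw [← h] at this
    exact lt_irrefl _ this
  let G : SimpleGraph V :=
    { Adj := fun u v => (u ≠ r ∧ v = par u) ∨ (v ≠ r ∧ u = par v)
      symm := ⟨fun u v h => h.symm⟩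
      loopless := ⟨fun u h => h.elim (fun h => hne u h.1 h.2) fun h => hne u h.1 h.2⟩ }
  have hadj : ∀ u v, G.Adj u v ↔ (u ≠ r ∧ v = par u) ∨ (v ≠ r ∧ u = par v) :=
    fun _ _ => Iff.rfl
  have hadj_leaf : ∀ v, c v ≠ v → ∀ w, G.Adj v w ↔ w = c v := by
    intro v hv w
    rw [hadj, par_leaf v hv]
    constructor
    · rintro (⟨-, h⟩ | ⟨-, rfl⟩)
      · exact h
      · exact absurd (cpar w) hv
    · exact fun h => Or.inl ⟨leaf_ne_root v hv, h⟩
  have hadj_center : ∀ u (hu : c u = u) v (hv : c v = v), G.Adj u v ↔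
      (e ⟨u, hu⟩).val + 1 = (e ⟨v, hv⟩).val ∨ (e ⟨v, hv⟩).val + 1 = (e ⟨u, hu⟩).val := by
    intro u hu v hv
    rw [hadj, par_center u hu v hv, par_center v hv u hu, hroot u hu, hroot v hv]
    omega
  have hpend : ∀ v, ¬ G.IsPendantVertex v ↔ c v = v := by
    intro v
    constructor
    · intro h
      by_contra hv
      exact h ⟨c v, (hadj_leaf v hv _).2 rfl, fun w hw => (hadj_leaf v hv w).1 hw⟩
    · intro hv hpen
      obtain ⟨u, huv, hcu⟩ := hleaf v hv
      have hu : c u ≠ u := fun h => huv (h.symm.trans hcu)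
      have h1 : G.Adj v u := ((hadj_leaf u hu v).2 hcu.symm).symm
      -- Besides its leaf, a center has a neighboring center since `2 ≤ n`, so it is not pendant.
      obtain ⟨k, hk⟩ : ∃ k : Fin n, (e ⟨v, hv⟩).val + 1 = k.val ∨ k.val + 1 = (e ⟨v, hv⟩).val := by
        by_cases h0 : (e ⟨v, hv⟩).val = 0
        · exact ⟨⟨1, by omega⟩, Or.inl (by rw [h0])⟩
        · exact ⟨⟨(e ⟨v, hv⟩).val - 1, by omega⟩, Or.inr (by simp only; omega)⟩
      have h2 : G.Adj v (e.symm k).1 := by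
        rw [hadj_center v hv _ (e.symm k).2]
        simpa using hk
      exact hu ((hpen.unique h1 h2) ▸ (e.symm k).2)
  have hset : {v | ¬ G.IsPendantVertex v} = Z := Set.ext hpend
  refine ⟨G, ⟨isTree_of_parent r par rank hrank hadj, n, ⟨⟨(Equiv.setCongr hset).trans e, ?_⟩⟩⟩,
    fun v hv => (hadj_leaf v hv _).2 rfl⟩
  rintro ⟨u, hu⟩ ⟨v, hv⟩
  rw [pathGraph_adj]
  exact (hadj_center u ((hpend u).1 hu) v ((hpend v).1 hv)).symm

/-- The map sending a duplicate-free list to its longest prefix that avoids `i`. -/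
def prefixAvoiding {α : Type*} [DecidableEq α] (i : α) (l : {l : List α // l.Nodup}) :
    {l : List α // l.Nodup} :=
  ⟨l.1.takeWhile (fun x => x ≠ i), l.2.sublist (List.takeWhile_sublist _)⟩

theorem takeWhile_ne_of_notMem {α : Type*} [DecidableEq α] {i : α} {l : List α} (h : i ∉ l) :
    l.takeWhile (fun x => x ≠ i) = l := by
  rw [List.takeWhile_eq_self_iff]
  intro x hx
  simpa using fun hxi : x = i => h (hxi ▸ hx)

theorem notMem_takeWhile_ne {α : Type*} [DecidableEq α] (i : α) (l : List α) :
    i ∉ l.takeWhile (fun x => x ≠ i) := fun h => by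
  simpa using List.mem_takeWhile_imp h

theorem takeWhile_ne_append {α : Type*} [DecidableEq α] {i : α} {l : List α} (h : i ∈ l)
    (l' : List α) : (l ++ l').takeWhile (fun x => x ≠ i) = l.takeWhile (fun x => x ≠ i) := by
  induction l with
  | nil => simp at h
  | cons x l ih =>
    by_cases hx : x = i
    · simp [hx]
    · have : i ∈ l := (List.mem_cons.1 h).resolve_left (Ne.symm hx)
      have := ih this
      simp_all

theorem takeWhile_ne_append_singleton {α : Type*} [DecidableEq α] {i : α} {l : List α}
    (h : i ∉ l) : (l ++ [i]).takeWhile (fun x => x ≠ i) = l := by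
  rw [List.takeWhile_append_of_pos]
  · simp
  · intro x hx
    simpa using fun hxi : x = i => h (hxi ▸ hx)

theorem card_nodup_list_le (m : ℕ) :
    Fintype.card {l : List (Fin m) // l.Nodup} ≤ (m + 1) ^ m := by
  have hinj : Function.Injective fun (l : {l : List (Fin m) // l.Nodup}) (k : Fin m) =>
      l.1[k.val]? := by
    intro l l' h
    have hlen : ∀ l : {l : List (Fin m) // l.Nodup}, l.1.length ≤ m := fun l => by
      simpa using l.2.length_le_card
    refine Subtype.ext (List.ext_getElem? fun k => ?_)
    by_cases hk : k < m
    · exact congrFun h ⟨k, hk⟩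
    · rw [List.getElem?_eq_none ((hlen l).trans (not_lt.1 hk)),
        List.getElem?_eq_none ((hlen l').trans (not_lt.1 hk))]
  simpa using Fintype.card_le_of_injective _ hinj

/-- No choice of a color for every duplicate-free list of colors is compatible with the star
forests in which a list containing `i` is attached to its longest prefix avoiding `i`. -/
theorem not_hasCooperativeColoring_of_adj_prefixAvoiding {m : ℕ}
    (G : Fin m → SimpleGraph {l : List (Fin m) // l.Nodup})
    (hG : ∀ i l, prefixAvoiding i l ≠ l → (G i).Adj l (prefixAvoiding i l)) :
    ¬ HasCooperativeColoring G := by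
  rintro ⟨I, hI, hcover⟩
  have hmem : ∀ l, ∃ i, l ∈ I i := fun l =>
    Set.mem_iUnion.1 (hcover.symm ▸ Set.mem_univ l)
  choose f hf using hmem
  -- Invariant: each entry of the list is the color of the prefix before it. If the color of `l`
  -- already occurred in `l`, then `l` and that prefix would be adjacent in that color.
  have hlists : ∀ k, ∃ l : {l : List (Fin m) // l.Nodup}, l.1.length = k ∧
      ∀ i ∈ l.1, f (prefixAvoiding i l) = i := by
    intro k
    induction k with
    | zero => exact ⟨⟨[], List.nodup_nil⟩, rfl, by simp⟩
    | succ k ih =>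
      obtain ⟨l, hlk, hl⟩ := ih
      have hnew : f l ∉ l.1 := by
        intro hmem
        have hne : prefixAvoiding (f l) l ≠ l := fun h =>
          notMem_takeWhile_ne (f l) l.1 (by rwa [← congrArg Subtype.val h] at hmem)
        exact hI (f l) (hf l) (by simpa [hl _ hmem] using hf (prefixAvoiding (f l) l)) hne.symm
          (hG _ _ hne)
      refine ⟨⟨l.1 ++ [f l], ?_⟩, by simp [hlk], fun i hi => ?_⟩
      · rw [← List.concat_eq_append]
        exact l.2.concat hnew
      · by_cases hil : i ∈ l.1
        · refine Eq.trans (congrArg f (Subtype.ext ?_)) (hl i hil)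
          exact takeWhile_ne_append hil _
        · obtain rfl : i = f l := by simpa [hil] using hi
          exact congrArg f (Subtype.ext (takeWhile_ne_append_singleton hil))
  obtain ⟨l, hl, -⟩ := hlists (m + 1)
  have := l.2.length_le_card
  simp [hl] at this

theorem not_cooperativelyColorable_isCaterpillar {d m : ℕ} (hm : 2 ≤ m)
    (hd : (m + 1) ^ m ≤ d) : ¬ CooperativelyColorable IsCaterpillar d m := by
  classical
  intro hcol
  have hcat : ∀ i : Fin m, ∃ G : SimpleGraph {l : List (Fin m) // l.Nodup}, G.IsCaterpillar ∧
      ∀ l, prefixAvoiding i l ≠ l → G.Adj l (prefixAvoiding i l) := by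
    intro i
    have hfix : ∀ l : {l : List (Fin m) // l.Nodup}, i ∉ l.1 → prefixAvoiding i l = l :=
      fun l hl => Subtype.ext (takeWhile_ne_of_notMem hl)
    refine exists_isCaterpillar_of_star_forest _
      (fun l => hfix _ (notMem_takeWhile_ne i l.1)) (fun l hl => ?_) ?_
    · have hil : i ∉ l.1 := by
        rw [← hl]
        exact notMem_takeWhile_ne i l.1
      refine ⟨⟨l.1 ++ [i], ?_⟩, fun h => ?_, Subtype.ext (takeWhile_ne_append_singleton hil)⟩
      · rw [← List.concat_eq_append]
        exact l.2.concat hil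
      · simpa using congrArg Subtype.val h
    · have : Nontrivial (Fin m) := Fin.nontrivial_iff_two_le.2 hm
      obtain ⟨j, hj⟩ := exists_ne i
      exact ⟨⟨[], List.nodup_nil⟩, ⟨[j], List.nodup_singleton j⟩, hfix _ (by simp),
        hfix _ (by simpa using hj.symm), by simp⟩
  choose G hG hadj using hcat
  refine not_hasCooperativeColoring_of_adj_prefixAvoiding G hadj (hcol _ G hG fun i => ?_)
  have : Nonempty {l : List (Fin m) // l.Nodup} := ⟨⟨[], List.nodup_nil⟩⟩
  exact (((G i).maxDegree_lt_card_verts).le.trans (card_nodup_list_le m)).trans hd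

/-! ### Existence of the minimum and asymptotics -/

theorem CooperativelyColorable.mono {𝒢 : ∀ {V : Type}, SimpleGraph V → Prop} {d m m' : ℕ}
    (h : CooperativelyColorable 𝒢 d m) (hm : m ≤ m') : CooperativelyColorable 𝒢 d m' := by
  intro V _ G hG hd
  obtain ⟨I, hI, hcover⟩ := h V (fun i => G (Fin.castLE hm i)) (fun i => hG _) fun i => hd _
  refine ⟨fun i => if hi : i.val < m then I ⟨i, hi⟩ else ∅, fun i => ?_, ?_⟩
  · by_cases hi : i.val < m
    · simpa [hi] using hI ⟨i, hi⟩
    · simp [hi, IsIndepSet]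
  · refine Set.eq_univ_of_forall fun v => ?_
    obtain ⟨i, hi⟩ := Set.mem_iUnion.1 (hcover.symm ▸ Set.mem_univ v)
    exact Set.mem_iUnion.2 ⟨Fin.castLE hm i, by simpa using hi⟩

theorem exists_cooperativelyColorable_isCaterpillar (d : ℕ) :
    ∃ m, CooperativelyColorable IsCaterpillar d m := by
  have hlim := tendsto_pow_const_div_const_pow_of_one_lt 2 (one_lt_two (α := ℝ))
  have hpos : (0 : ℝ) < 1 / (260 * (d + 1)) := by positivity
  obtain ⟨n, hn, hn1⟩ := ((hlim.eventually_lt_const hpos).and (eventually_ge_atTop 1)).exists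
  rw [div_lt_div_iff₀ (by positivity) (by positivity), one_mul] at hn
  have h1 : n ^ 2 * (260 * (d + 1)) < 2 ^ n := by exact_mod_cast hn
  -- With `N = 2`, the power 2^n outgrows the quadratic left side.
  refine ⟨n + 32 * 2, cooperativelyColorable_isCaterpillar 2 n hn1 two_pos le_rfl
    (le_trans ?_ h1.le)⟩
  calc 4 * n * ((n + 32 * 2) * d) ≤ 4 * n * ((65 * n) * (d + 1)) := by gcongr <;> omega
    _ = n ^ 2 * (260 * (d + 1)) := by ring

theorem lt_cooperativeNumber_isCaterpillar {d m : ℕ} (hm : 2 ≤ m) (hd : (m + 1) ^ m ≤ d) :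
    m < cooperativeNumber IsCaterpillar d := by
  by_contra! h
  have hmem : CooperativelyColorable IsCaterpillar d (cooperativeNumber IsCaterpillar d) :=
    Nat.sInf_mem (exists_cooperativelyColorable_isCaterpillar d)
  exact not_cooperativelyColorable_isCaterpillar hm hd (hmem.mono h)

theorem tendsto_log_natCast_atTop : Tendsto (fun d : ℕ => Real.log d) atTop atTop :=
  Real.tendsto_log_atTop.comp tendsto_natCast_atTop_atTop

theorem tendsto_div_log_atTop : Tendsto (fun y : ℝ => y / Real.log y) atTop atTop := by
  have h := Real.isLittleO_log_id_atTop.tendsto_div_nhds_zero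
  have h2 : Tendsto (fun y : ℝ => Real.log y / y) atTop (nhdsWithin 0 (Set.Ioi 0)) := by
    refine tendsto_nhdsWithin_iff.2 ⟨h, ?_⟩
    filter_upwards [eventually_gt_atTop 1] with y hy
    exact div_pos (Real.log_pos hy) (by linarith)
  refine h2.inv_tendsto_nhdsGT_zero.congr fun y => ?_
  simp

theorem eventually_le_cooperativeNumber_isCaterpillar :
    ∀ᶠ d : ℕ in atTop, Real.log d / Real.log (Real.log d) ≤
      (cooperativeNumber IsCaterpillar d : ℝ) := by
  have hy := tendsto_log_natCast_atTop
  filter_upwards [hy.eventually_ge_atTop 2,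
    (Real.tendsto_log_atTop.comp hy).eventually_ge_atTop 2,
    (tendsto_div_log_atTop.comp hy).eventually_ge_atTop 2, eventually_gt_atTop 0]
    with d h1 h2 h3 hd
  simp only [Function.comp_apply] at h2 h3
  set y := Real.log d with hyd
  set x := y / Real.log y with hx
  have hd0 : (0 : ℝ) < d := by exact_mod_cast hd
  have hx0 : 0 ≤ x := by linarith
  have hxl : x * Real.log y = y := div_mul_cancel₀ _ (by linarith)
  -- Ensures log(⌊x⌋ + 1) ≤ log y, hence ⌊x⌋ log(⌊x⌋ + 1) ≤ x log y = log d.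
  have hxy : x + 1 ≤ y := by nlinarith
  have hfl : (⌊x⌋₊ : ℝ) ≤ x := Nat.floor_le hx0
  have hpow : (⌊x⌋₊ + 1) ^ ⌊x⌋₊ ≤ d := by
    have : (((⌊x⌋₊ + 1) ^ ⌊x⌋₊ : ℕ) : ℝ) ≤ d := by
      push_cast
      rw [← Real.log_le_log_iff (by positivity) hd0, Real.log_pow, ← hyd]
      calc (⌊x⌋₊ : ℝ) * Real.log (⌊x⌋₊ + 1) ≤ x * Real.log y := by
            gcongr
            · exact Real.log_nonneg (by linarith [Nat.cast_nonneg (α := ℝ) ⌊x⌋₊])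
            · linarith
        _ = y := hxl
    exact_mod_cast this
  have hlt := lt_cooperativeNumber_isCaterpillar (Nat.le_floor (by exact_mod_cast h3)) hpow
  have : ((⌊x⌋₊ + 1 : ℕ) : ℝ) ≤ (cooperativeNumber IsCaterpillar d : ℝ) := by
    exact_mod_cast hlt
  push_cast at this
  linarith [Nat.lt_floor_add_one x]

theorem eventually_cooperativeNumber_isCaterpillar_le {ε : ℝ} (hε : 0 < ε) (hε1 : ε ≤ 1) :
    ∀ᶠ d : ℕ in atTop, (cooperativeNumber IsCaterpillar d : ℝ) ≤
      (1 + ε) * (Real.log d / Real.log (Real.log d)) := by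
  have hy := tendsto_log_natCast_atTop
  have hexp : ∀ᶠ y : ℝ in atTop, 16 * y ^ 2 ≤ Real.exp (ε / 4 * y) := by
    filter_upwards [(isLittleO_pow_exp_pos_mul_atTop 2 (show 0 < ε / 4 by positivity)).def
      (show (0 : ℝ) < 1 / 16 by norm_num)] with y h
    rw [Real.norm_of_nonneg (sq_nonneg y), Real.norm_of_nonneg (Real.exp_pos _).le] at h
    linarith
  have hloglog : ∀ᶠ y : ℝ in atTop, Real.log y ≤ ε / 8 * y + Real.log (ε / 256) := by
    filter_upwards [Real.isLittleO_log_id_atTop.def (show 0 < ε / 16 by positivity),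
      eventually_ge_atTop 0, eventually_ge_atTop (-Real.log (ε / 256) / (ε / 16))] with y h h0 h1
    rw [div_le_iff₀ (by positivity)] at h1
    simp only [id, Real.norm_of_nonneg h0] at h
    linarith [Real.le_norm_self (Real.log y)]
  filter_upwards [hy.eventually_ge_atTop 2, hy.eventually hexp,
    (Real.tendsto_log_atTop.comp hy).eventually_ge_atTop 2,
    (Real.tendsto_log_atTop.comp hy).eventually hloglog,
    (tendsto_div_log_atTop.comp hy).eventually_ge_atTop (256 / ε), eventually_gt_atTop 0]
    with d h1 hE h2 hll h3 hd
  simp only [Function.comp_apply] at h2 h3 hll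
  set y := Real.log d with hyd
  set x := y / Real.log y with hx
  have hd0 : (0 : ℝ) < d := by exact_mod_cast hd
  rw [div_le_iff₀ hε] at h3
  have hx0 : 0 < x := div_pos (by linarith) (by linarith)
  have hxl : x * Real.log y = y := div_mul_cancel₀ _ (by linarith)
  have hxy : x ≤ y := by nlinarith
  set m := ⌊(1 + ε) * x⌋₊ with hm
  -- Then 32N ≤ εx/4, leaving `s` at least (1 + ε/2)x, while log N is still (1 - o(1)) log y.
  set N := ⌊ε / 128 * x⌋₊ with hN
  have hm1 : (m : ℝ) ≤ (1 + ε) * x := Nat.floor_le (by positivity)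
  have hm2 : (1 + ε) * x < m + 1 := Nat.lt_floor_add_one _
  have hN1 : (N : ℝ) ≤ ε / 128 * x := Nat.floor_le (by positivity)
  have hN2 : ε / 128 * x < N + 1 := Nat.lt_floor_add_one _
  have hN3 : ε / 256 * x ≤ N := by linarith
  have hNpos : 0 < N := by
    have : (0 : ℝ) < N := lt_of_lt_of_le (by positivity) hN3
    exact_mod_cast this
  have hNm : 32 * N ≤ m := by
    have : ((32 * N : ℕ) : ℝ) ≤ m := by
      push_cast
      nlinarith
    exact_mod_cast this
  have hs1 : (1 + ε / 2) * x ≤ ((m - 32 * N : ℕ) : ℝ) := by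
    rw [Nat.cast_sub hNm]
    push_cast
    nlinarith
  have hs2 : ((m - 32 * N : ℕ) : ℝ) ≤ 2 * x := by
    have : ((m - 32 * N : ℕ) : ℝ) ≤ m := by exact_mod_cast Nat.sub_le _ _
    nlinarith
  set s := m - 32 * N with hs
  have hspos : 0 < s := by
    have : (0 : ℝ) < s := lt_of_lt_of_le (by positivity) hs1
    exact_mod_cast this
  have hlogN : (1 - ε / 8) * Real.log y ≤ Real.log N := by
    have h4 : Real.log (ε / 256 * x) ≤ Real.log N := Real.log_le_log (by positivity) hN3
    have h5 : Real.log x = Real.log y - Real.log (Real.log y) :=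
      Real.log_div (by linarith) (by linarith)
    rw [Real.log_mul (by positivity) hx0.ne', h5] at h4
    linarith
  -- Since ε ≤ 1, (1 + ε/2)(1 - ε/8) ≥ 1 + ε/4; the surplus exp(εy/4) absorbs the factor 4sm ≤ 16y².
  have hslog : (1 + ε / 4) * y ≤ s * Real.log N :=
    calc (1 + ε / 4) * y ≤ ((1 + ε / 2) * (1 - ε / 8)) * y := by
          gcongr
          nlinarith
      _ = ((1 + ε / 2) * (1 - ε / 8)) * (x * Real.log y) := by rw [hxl]
      _ = ((1 + ε / 2) * x) * ((1 - ε / 8) * Real.log y) := by ring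
      _ ≤ s * Real.log N := by
          gcongr
          exact mul_nonneg (by linarith) (by linarith)
  have hmain : 4 * s * (m * d) ≤ N ^ s := by
    have hreal : (4 * s * (m * d) : ℝ) ≤ (N : ℝ) ^ s :=
      calc (4 * s * (m * d) : ℝ) ≤ 4 * (2 * y) * ((2 * y) * d) := by
            gcongr
            · linarith
            · nlinarith
        _ = 16 * y ^ 2 * d := by ring
        _ ≤ Real.exp (ε / 4 * y) * Real.exp y := by
            rw [hyd, Real.exp_log hd0]
            gcongr
        _ = Real.exp ((1 + ε / 4) * y) := by rw [← Real.exp_add]; ring_nf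
        _ ≤ Real.exp (s * Real.log N) := Real.exp_le_exp.2 hslog
        _ = (N : ℝ) ^ s := by
            rw [Real.exp_nat_mul, Real.exp_log (by exact_mod_cast hNpos)]
    exact_mod_cast hreal
  have hcol : CooperativelyColorable IsCaterpillar d m :=
    cooperativelyColorable_isCaterpillar N s hspos hNpos (by omega) hmain
  have : (cooperativeNumber IsCaterpillar d : ℝ) ≤ m := by exact_mod_cast Nat.sInf_le hcol
  exact this.trans hm1

end SimpleGraph

/-- For the class of caterpillars the minimum that defines `m(d)` exists for every `d`, and
`m(d) = (1 + o(1)) log d / log log d` as `d → ∞`. -/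
theorem mainTheorem8 :
    (∀ d : ℕ, ∃ m : ℕ, SimpleGraph.CooperativelyColorable SimpleGraph.IsCaterpillar d m) ∧
    (fun d : ℕ => (SimpleGraph.cooperativeNumber SimpleGraph.IsCaterpillar d : ℝ))
      ~[atTop] (fun d : ℕ => Real.log (d : ℝ) / Real.log (Real.log (d : ℝ))) := by
  refine ⟨SimpleGraph.exists_cooperativelyColorable_isCaterpillar, isLittleO_iff.2 fun ε hε => ?_⟩
  filter_upwards [SimpleGraph.eventually_le_cooperativeNumber_isCaterpillar,
    SimpleGraph.eventually_cooperativeNumber_isCaterpillar_le (lt_min hε one_pos)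
      (min_le_right ε 1),
    (SimpleGraph.tendsto_div_log_atTop.comp
      SimpleGraph.tendsto_log_natCast_atTop).eventually_ge_atTop 0] with d h1 h2 h0
  simp only [Function.comp_apply] at h0
  rw [Pi.sub_apply, Real.norm_of_nonneg (sub_nonneg.2 h1), Real.norm_of_nonneg h0]
  nlinarith [mul_le_mul_of_nonneg_right (min_le_left ε 1) h0]
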